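/- Let $k\ge 2$, let $A_1,\dots,A_k\in \mathrm{GL}(2,\mathbb{R})$, and let $T$ be the shift on $\Omega=\{1,\dots,k\}^{\mathbb{Z}}$. For $\omega\in\Omega$ and $n\ge 0$ write $A^{(n)}(\omega)=A_{\omega_{n-1}}\cdots A_{\omega_0}$. For a $T$-invariant Borel probability measure $\mu$ on $\Omega$ let $\lambda_1(\mu)=\int \lim_{n\to\infty}\frac1n\log\|A^{(n)}(\omega)\|\,d\mu(\omega)$ (the limit exists $\mu$-a.e.), where $\|\cdot\|$ is the Euclidean operator norm, and put $\lambda_1^\top=\sup_\mu\lambda_1(\mu)$ and $\lambda_1^\bot=\inf_\mu\lambda_1(\mu)$, over all such $\mu$. Assume that the one-step cocycle generated by $(A_1,\dots,A_k)$ is dominated: for every $\omega\in\Omega$ there is a splitting $\mathbb{R}^2=e_1(\omega)\oplus e_2(\omega)$ into one-dimensional subspaces with $A_{\omega_0}e_i(\omega)=e_i(T\omega)$ for $i=1,2$, and there are constants $c,\delta>0$ such that $\|A^{(n)}(\omega)|_{e_1(\omega)}\|\ge c\,e^{\delta n}\,\|A^{(n)}(\omega)|_{e_2(\omega)}\|$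 for all $\omega\in\Omega$ and $n\ge1$. A cone is an image of $\{(x_1,x_2)\in\mathbb{R}^2\setminus\{0\}: x_1x_2\ge0\}$ under a linear isomorphism, and a multicone is a disjoint union of finitely many (at least one) cones. Let $M$ be a multicone that is forward-invariant, i.e. $\bigcup_i A_i(M)$ is contained in the interior of $M$. Then there exist functions $p^\top, p^\bot\colon M\to\mathbb{R}$ with the following properties. 1. (Extremality) For all $x\in M$, $$\max_{1\le i\le k}p^\top(A_ix)=p^\top(x)+\lambda_1^\top,\qquad \min_{1\le i\le k}p^\bot(A_ix)=p^\bot(x)+\lambda_1^\bot .$$ 2. (Log-homogeneity) For all $\star\in\{\top,\bot\}$, $x\in M$ and $t\in\mathbb{R}\setminus\{0\}$, $p^\star(tx)=p^\star(x)+\log|t|$. 3. (Regularity) There is a constant $c_0>0$ such that for all $\star\in\{\top,\bot\}$ and $x,y\in M$, $$|p^\star(x)-p^\star(y)|\le c_0\,\angle(x,y)+\big|\log\|x\|-\log\|y\|\big| ,$$ where $\angle(x,y)\in[0,\pi/2]$ is the angle between the lines spanned by $x$ and $y$, and $\|\cdot\|$ is the Euclidean norm. -/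

import Mathlib

open MeasureTheory Filter Topology

noncomputable section

namespace Barabanov

/-- The Euclidean plane. -/
abbrev Plane : Type := EuclideanSpace ℝ (Fin 2)

/-- The linear action of an invertible matrix on the Euclidean plane; its norm is the
Euclidean operator norm of the matrix. -/
def act (g : GL (Fin 2) ℝ) : Plane →L[ℝ] Plane :=
  Matrix.toEuclideanCLM (n := Fin 2) (𝕜 := ℝ) (g : Matrix (Fin 2) (Fin 2) ℝ)

section Cocycle

/-- The products `A(T^{n-1} ω) ⋯ A(T ω) A(ω)` of the matrix cocycle `(T, A)`. -/
def cocycleProd {Ω : Type*} (T : Ω → Ω) (A : Ω → GL (Fin 2) ℝ) : ℕ → Ω → GL (Fin 2) ℝ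
  | 0, _ => 1
  | n + 1, ω => A (T^[n] ω) * cocycleProd T A n ω

/-- The first Lyapunov exponent at a point, `lim (1/n) log ‖A^{(n)}(ω)‖`. It is written as an
upper limit so that it has a value also at the points where the limit does not exist; those
form a null set for every invariant probability measure. -/
def lyapunovAt {Ω : Type*} (T : Ω → Ω) (A : Ω → GL (Fin 2) ℝ) (ω : Ω) : ℝ :=
  limsup (fun n : ℕ => (1 / (n : ℝ)) * Real.log ‖act (cocycleProd T A n ω)‖) atTop

/-- The first Lyapunov exponent of an invariant measure. -/
def lyapunov {Ω : Type*} [MeasurableSpace Ω] (T : Ω → Ω) (A : Ω → GL (Fin 2) ℝ)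
    (μ : Measure Ω) : ℝ :=
  ∫ ω, lyapunovAt T A ω ∂μ

/-- The set of `T`-invariant probability measures. -/
def invariantMeasures {Ω : Type*} [MeasurableSpace Ω] (T : Ω → Ω) : Set (Measure Ω) :=
  {μ | IsProbabilityMeasure μ ∧ MeasurePreserving T μ μ}

/-- The maximal first Lyapunov exponent: a supremum over the invariant probability measures. -/
def lyapunovTop {Ω : Type*} [MeasurableSpace Ω] (T : Ω → Ω) (A : Ω → GL (Fin 2) ℝ) : ℝ :=
  sSup (lyapunov T A '' invariantMeasures T)

/-- The minimal first Lyapunov exponent: an infimum over the invariant probability measures. -/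
def lyapunovBot {Ω : Type*} [MeasurableSpace Ω] (T : Ω → Ω) (A : Ω → GL (Fin 2) ℝ) : ℝ :=
  sInf (lyapunov T A '' invariantMeasures T)

/-- The norm of the restriction of `g` to a subspace. -/
def restrNorm (g : GL (Fin 2) ℝ) (e : Submodule ℝ Plane) : ℝ :=
  ‖(act g).comp e.subtypeL‖

/-- `e₁ ⊕ e₂` is a dominated splitting of the plane for the cocycle `(T, A)`. -/
structure IsDominatedSplitting {Ω : Type*} (T : Ω → Ω) (A : Ω → GL (Fin 2) ℝ)
    (e₁ e₂ : Ω → Submodule ℝ Plane) : Prop where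
  finrank_fst : ∀ ω, Module.finrank ℝ (e₁ ω) = 1
  finrank_snd : ∀ ω, Module.finrank ℝ (e₂ ω) = 1
  isCompl : ∀ ω, IsCompl (e₁ ω) (e₂ ω)
  equivariant_fst : ∀ ω, (e₁ ω).map (act (A ω)).toLinearMap = e₁ (T ω)
  equivariant_snd : ∀ ω, (e₂ ω).map (act (A ω)).toLinearMap = e₂ (T ω)
  dominance : ∃ c > (0 : ℝ), ∃ δ > (0 : ℝ), ∀ ω, ∀ n : ℕ, 1 ≤ n →
    c * Real.exp (δ * n) ≤
      restrNorm (cocycleProd T A n ω) (e₁ ω) / restrNorm (cocycleProd T A n ω) (e₂ ω)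

/-- The cocycle `(T, A)` is dominated. -/
def IsDominated {Ω : Type*} (T : Ω → Ω) (A : Ω → GL (Fin 2) ℝ) : Prop :=
  ∃ e₁ e₂ : Ω → Submodule ℝ Plane, IsDominatedSplitting T A e₁ e₂

end Cocycle

section OneStep

/-- The shift on bi-infinite words in `k` symbols. -/
def shift (k : ℕ) (ω : ℤ → Fin k) : ℤ → Fin k := fun n => ω (n + 1)

/-- The one-step cocycle map `ω ↦ A_{ω₀}`. -/
def oneStep {k : ℕ} (A : Fin k → GL (Fin 2) ℝ) (ω : ℤ → Fin k) : GL (Fin 2) ℝ := A (ω 0)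

/-- The maximal first Lyapunov exponent of the one-step cocycle generated by `A`. -/
def lambdaTop {k : ℕ} (A : Fin k → GL (Fin 2) ℝ) : ℝ := lyapunovTop (shift k) (oneStep A)

/-- The minimal first Lyapunov exponent of the one-step cocycle generated by `A`. -/
def lambdaBot {k : ℕ} (A : Fin k → GL (Fin 2) ℝ) : ℝ := lyapunovBot (shift k) (oneStep A)

end OneStep

section Multicone

/-- The standard positive cone `{(x, y) ≠ 0 : x y ≥ 0}`. -/
def stdCone : Set Plane := {v | v ≠ 0 ∧ 0 ≤ v 0 * v 1}

/-- A cone: a linear image of the standard positive cone. -/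
def IsCone (C : Set Plane) : Prop := ∃ L : Plane ≃ₗ[ℝ] Plane, C = L '' stdCone

/-- A multicone: a disjoint union of finitely many (at least one) cones. -/
def IsMulticone (M : Set Plane) : Prop :=
  ∃ (n : ℕ) (C : Fin n → Set Plane), 0 < n ∧ (∀ j, IsCone (C j)) ∧
    (∀ i j, i ≠ j → Disjoint (C i) (C j)) ∧ M = ⋃ j, C j

/-- The images of `M` under all the matrices lie in the interior of `M`. -/
def IsForwardInvariant {k : ℕ} (A : Fin k → GL (Fin 2) ℝ) (M : Set Plane) : Prop :=
  (⋃ i, act (A i) '' M) ⊆ interior M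

end Multicone

/-- The angle in `[0, π/2]` between the lines spanned by two nonzero vectors. -/
def lineAngle (x y : Plane) : ℝ :=
  min (InnerProductGeometry.angle x y) (Real.pi - InnerProductGeometry.angle x y)

end Barabanov

end

open MeasureTheory Filter Topology

noncomputable section

namespace Barabanov

/-! ### Matrices acting on the plane -/

section LinearAction

/-! Along a product `B` of the matrices, every vector `x` of `M` is stretched almost as much as the
operator norm allows: `‖B‖ ‖x‖ ≤ c ‖B x‖` with `c` independent of `B` (`exists_norm_mul_norm_le`).
The reason is that `M` misses a line, while forward invariance puts a ball of uniform radius around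
each first image of a unit vector into `M`. If `B` stretched some other direction far more than `x`,
it would send a point of such a ball onto the missed line.

Hence `log ‖B x‖` is `log ‖B‖ + log ‖x‖` up to a bounded error, and it varies with `x` in a
Lipschitz way that is uniform in the length of `B`. Let `W n x` be the maximum of `σ log ‖B x‖` over
products of length `n`, with `σ = 1` for the maximal exponent and `σ = -1` for the minimal one. It
satisfies `W (n+1) x = max_i W n (A_i x)` and is almost additive, so it stays within bounded
distance of `n l` for some `l` (`exists_abs_wordMax_sub_le`). The function `p x = limsup (W n x - n
l)` is then finite on `M`. A limsup commutes with finite maxima, so the recursion becomes `max_i p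
(A_i x) = p x + l`, and homogeneity and regularity pass to the limit.

It remains to identify `l` as the supremum of `σ λ₁(μ)`. The upper bound holds pointwise. For the
lower bound, repeating an optimal word of length `N` periodically loses at most `2K/N`, where `K` is
the uniform error (`exists_le_along_periodic_orbit`). -/

theorem act_one : act 1 = ContinuousLinearMap.id ℝ Plane := by
  simp only [act, Units.val_one, map_one]
  rfl

theorem act_mul_apply (g h : GL (Fin 2) ℝ) (x : Plane) : act (g * h) x = act g (act h x) := by
  simp only [act, Units.val_mul, map_mul]
  rfl

theorem act_inv_act (g : GL (Fin 2) ℝ) (x : Plane) : act g⁻¹ (act g x) = x := by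
  rw [← act_mul_apply, inv_mul_cancel, act_one]
  rfl

theorem act_ne_zero (g : GL (Fin 2) ℝ) {x : Plane} (hx : x ≠ 0) : act g x ≠ 0 := by
  intro h
  apply hx
  rw [← act_inv_act g x, h, map_zero]

theorem norm_act_pos (g : GL (Fin 2) ℝ) : 0 < ‖act g‖ := by
  obtain ⟨x, hx⟩ := exists_ne (0 : Plane)
  by_contra! h
  have h0 : act g = 0 := norm_le_zero_iff.1 h
  exact act_ne_zero g hx (by rw [h0]; rfl)

end LinearAction

/-! ### Geometry of multicones and uniform expansion -/

section Multicone

/-- A cone omits the origin, which is its only missing limit point. -/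
theorem isClosed_insert_zero_cone {C : Set Plane} (hC : IsCone C) : IsClosed (insert 0 C) := by
  obtain ⟨L, rfl⟩ := hC
  have h : insert 0 (L '' stdCone) = L.toContinuousLinearEquiv '' {v | 0 ≤ v 0 * v 1} := by
    ext z
    simp only [Set.mem_insert_iff, Set.mem_image, stdCone, Set.mem_ofPred_eq,
      LinearEquiv.coe_toContinuousLinearEquiv']
    constructor
    · rintro (rfl | ⟨v, hv, rfl⟩)
      · exact ⟨0, by simp, by simp⟩
      · exact ⟨v, hv.2, rfl⟩
    · rintro ⟨v, hv, rfl⟩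
      by_cases h0 : v = 0
      · left; simp [h0]
      · exact Or.inr ⟨v, ⟨h0, hv⟩, rfl⟩
  rw [h]
  exact L.toContinuousLinearEquiv.toHomeomorph.isClosed_image.2
    (isClosed_le continuous_const (by fun_prop))

theorem zero_notMem_cone {C : Set Plane} (hC : IsCone C) : (0 : Plane) ∉ C := by
  obtain ⟨L, rfl⟩ := hC
  rintro ⟨v, hv, h⟩
  exact hv.1 (by simpa using h)

theorem smul_mem_cone {C : Set Plane} (hC : IsCone C) {x : Plane} (hx : x ∈ C) {t : ℝ}
    (ht : t ≠ 0) : t • x ∈ C := by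
  obtain ⟨L, rfl⟩ := hC
  obtain ⟨v, hv, rfl⟩ := hx
  refine ⟨t • v, ⟨smul_ne_zero ht hv.1, ?_⟩, by simp⟩
  have : (t • v) 0 * (t • v) 1 = t ^ 2 * (v 0 * v 1) := by simp; ring
  rw [this]
  exact mul_nonneg (sq_nonneg t) hv.2

variable {M : Set Plane}

theorem IsMulticone.zero_notMem (hM : IsMulticone M) : (0 : Plane) ∉ M := by
  obtain ⟨n, C, -, hC, -, rfl⟩ := hM
  simp only [Set.mem_iUnion, not_exists]
  exact fun i => zero_notMem_cone (hC i)

theorem IsMulticone.ne_zero (hM : IsMulticone M) {x : Plane} (hx : x ∈ M) : x ≠ 0 :=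
  fun h => hM.zero_notMem (h ▸ hx)

theorem IsMulticone.smul_mem (hM : IsMulticone M) {x : Plane} (hx : x ∈ M) {t : ℝ}
    (ht : t ≠ 0) : t • x ∈ M := by
  obtain ⟨n, C, -, hC, -, rfl⟩ := hM
  obtain ⟨i, hi⟩ := Set.mem_iUnion.1 hx
  exact Set.mem_iUnion.2 ⟨i, smul_mem_cone (hC i) hi ht⟩

theorem isClosed_insert_zero_iUnion_cone {ι : Type*} [Finite ι] {C : ι → Set Plane}
    (hC : ∀ i, IsCone (C i)) : IsClosed (insert 0 (⋃ i, C i)) := by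
  have h : insert 0 (⋃ i, C i) = {0} ∪ ⋃ i, insert 0 (C i) := by
    ext z
    simp only [Set.mem_insert_iff, Set.mem_iUnion, Set.mem_union, Set.mem_singleton_iff]
    constructor
    · rintro (h | ⟨i, hi⟩)
      · exact Or.inl h
      · exact Or.inr ⟨i, Or.inr hi⟩
    · rintro (h | ⟨i, h | hi⟩)
      · exact Or.inl h
      · exact Or.inl h
      · exact Or.inr ⟨i, hi⟩
  rw [h]
  exact isClosed_singleton.union (isClosed_iUnion_of_finite fun i => isClosed_insert_zero_cone (hC i))

theorem IsMulticone.isClosed_insert_zero (hM : IsMulticone M) : IsClosed (insert 0 M) := by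
  obtain ⟨n, C, -, hC, -, rfl⟩ := hM
  exact isClosed_insert_zero_iUnion_cone hC

theorem IsMulticone.nonempty (hM : IsMulticone M) : M.Nonempty := by
  obtain ⟨n, C, hn, hC, -, rfl⟩ := hM
  obtain ⟨L, hL⟩ := hC ⟨0, hn⟩
  refine ⟨L (WithLp.toLp 2 ![1, 0]), Set.mem_iUnion.2 ⟨⟨0, hn⟩, hL ▸ ⟨_, ⟨?_, by simp⟩, rfl⟩⟩⟩
  intro h
  simpa using congrArg (fun v : Plane => v 0) h

/-- A multicone misses a line: just outside a boundary ray of one of its cones there is nothing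
of that cone, and the other cones stay away from that ray. -/
theorem IsMulticone.exists_ne_zero_notMem (hM : IsMulticone M) : ∃ d : Plane, d ≠ 0 ∧ d ∉ M := by
  obtain ⟨n, C, hn, hC, hdisj, rfl⟩ := hM
  set j : Fin n := ⟨0, hn⟩
  obtain ⟨L, hL⟩ := hC j
  by_contra! hall
  -- For `s > 0` these vectors lie outside the standard cone and tend to its boundary vector `(1,
  -- 0)` as `s → 0`. If `M` were everything, their images would lie in the other cones, and so would
  -- the limit, against disjointness.
  have hw : ∀ s : ℝ, (WithLp.toLp 2 ![1, -s] : Plane) ≠ 0 := fun s h => by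
    simpa using congrArg (fun v : Plane => v 0) h
  have hF : IsClosed (insert 0 (⋃ i : {i : Fin n // i ≠ j}, C i)) :=
    isClosed_insert_zero_iUnion_cone fun i => hC i
  have hmem : ∀ s : ℝ, 0 < s →
      L (WithLp.toLp 2 ![1, -s]) ∈ insert 0 (⋃ i : {i : Fin n // i ≠ j}, C i) := by
    intro s hs
    obtain ⟨i, hi⟩ := Set.mem_iUnion.1 (hall _ (L.map_ne_zero_iff.2 (hw s)))
    refine Or.inr (Set.mem_iUnion.2 ⟨⟨i, ?_⟩, hi⟩)
    rintro rfl
    rw [hL] at hi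
    obtain ⟨v, hv, hv'⟩ := hi
    rw [L.injective hv'] at hv
    have := hv.2
    simp at this
    linarith
  have hcont : Continuous fun s : ℝ => L (WithLp.toLp 2 ![1, -s]) := by
    refine L.toContinuousLinearEquiv.continuous.comp ((PiLp.continuous_toLp 2 _).comp ?_)
    refine continuous_pi fun i => ?_
    fin_cases i <;> simp <;> fun_prop
  have hlim : Tendsto (fun s : ℝ => L (WithLp.toLp 2 ![1, -s])) (𝓝[>] 0)
      (𝓝 (L (WithLp.toLp 2 ![1, -0]))) := hcont.continuousAt.mono_left nhdsWithin_le_nhds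
  have h0 := hF.mem_of_tendsto hlim (eventually_nhdsWithin_of_forall hmem)
  rcases h0 with h0 | h0
  · exact L.map_ne_zero_iff.2 (hw 0) h0
  · obtain ⟨i, hi⟩ := Set.mem_iUnion.1 h0
    refine Set.disjoint_left.1 (hdisj i j i.2) hi ?_
    rw [hL]
    exact ⟨_, ⟨hw 0, by simp⟩, rfl⟩

theorem IsMulticone.isCompact_inter_sphere (hM : IsMulticone M) :
    IsCompact (M ∩ Metric.sphere 0 1) := by
  have h : M ∩ Metric.sphere 0 1 = insert 0 M ∩ Metric.sphere 0 1 := by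
    ext z
    simp only [Set.mem_inter_iff, Set.mem_insert_iff, mem_sphere_zero_iff_norm]
    constructor
    · exact fun h => ⟨Or.inr h.1, h.2⟩
    · rintro ⟨rfl | h, h1⟩
      · simp at h1
      · exact ⟨h, h1⟩
  rw [h, Set.inter_comm]
  exact (isCompact_sphere 0 1).inter_right hM.isClosed_insert_zero

theorem IsMulticone.normalize_mem (hM : IsMulticone M) {x : Plane} (hx : x ∈ M) :
    ‖x‖⁻¹ • x ∈ M ∩ Metric.sphere 0 1 := by
  have h : ‖x‖ ≠ 0 := norm_ne_zero_iff.2 (hM.ne_zero hx)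
  refine ⟨hM.smul_mem hx (inv_ne_zero h), ?_⟩
  simp [norm_smul, h]

/-- A linear functional that is bounded away from zero on a multicone. -/
theorem IsMulticone.exists_functional (hM : IsMulticone M) :
    ∃ φ : Plane →L[ℝ] ℝ, ∃ κ > (0 : ℝ), ∀ z ∈ M, κ * ‖z‖ ≤ |φ z| := by
  obtain ⟨d, hd, hdM⟩ := hM.exists_ne_zero_notMem
  -- This is `det(d, ·)`, whose kernel is the line through `d`, missed by `M`.
  let φ : Plane →L[ℝ] ℝ := d 0 • EuclideanSpace.proj 1 - d 1 • EuclideanSpace.proj 0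
  have hφ : ∀ z, φ z = d 0 * z 1 - d 1 * z 0 := fun z => by simp [φ]
  have hne : ∀ z ∈ M, φ z ≠ 0 := by
    intro z hz h
    rw [hφ] at h
    have hdd : 0 < d 0 ^ 2 + d 1 ^ 2 := by
      by_contra! hle
      apply hd
      have h0 : d 0 = 0 := by nlinarith [sq_nonneg (d 0), sq_nonneg (d 1)]
      have h1 : d 1 = 0 := by nlinarith [sq_nonneg (d 0), sq_nonneg (d 1)]
      ext i
      fin_cases i <;> simp [h0, h1]
    have hz0 : ∀ i, (d 0 ^ 2 + d 1 ^ 2) * z i = (d 0 * z 0 + d 1 * z 1) * d i := by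
      intro i
      fin_cases i
      · simp; linear_combination (-d 1) * h
      · simp; linear_combination (d 0) * h
    have ht : d 0 * z 0 + d 1 * z 1 ≠ 0 := by
      intro ht
      apply hM.ne_zero hz
      ext i
      have := hz0 i
      rw [ht, zero_mul] at this
      simpa [hdd.ne'] using this
    apply hdM
    have : d = ((d 0 * z 0 + d 1 * z 1)⁻¹ * (d 0 ^ 2 + d 1 ^ 2)) • z := by
      ext i
      rw [PiLp.smul_apply, smul_eq_mul, mul_assoc, hz0 i, inv_mul_cancel_left₀ ht]
    rw [this]
    exact hM.smul_mem hz (mul_ne_zero (inv_ne_zero ht) hdd.ne')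
  obtain ⟨x, hx⟩ := hM.nonempty
  obtain ⟨z₀, hz₀, hmin⟩ := hM.isCompact_inter_sphere.exists_isMinOn
    ⟨_, hM.normalize_mem hx⟩ (f := fun z => |φ z|) (by fun_prop)
  refine ⟨φ, |φ z₀|, abs_pos.2 (hne z₀ hz₀.1), fun z hz => ?_⟩
  have hpos : 0 < ‖z‖ := norm_pos_iff.2 (hM.ne_zero hz)
  have h1 : |φ z₀| ≤ |φ (‖z‖⁻¹ • z)| := hmin (hM.normalize_mem hz)
  rw [map_smul, smul_eq_mul, abs_mul, abs_inv, abs_norm, inv_mul_eq_div, le_div_iff₀ hpos] at h1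
  exact h1

/-- If a linear map carries a ball around `x` into the multicone `M`, it expands `x` almost as
much as any other vector. -/
theorem exists_norm_apply_ge_of_mapsTo (hM : IsMulticone M) :
    ∃ K > (0 : ℝ), ∀ (B : Plane →L[ℝ] Plane) (x : Plane) (ε : ℝ), 0 < ε →
      (∀ z ∈ Metric.closedBall x ε, B z ∈ M) → ε * ‖B‖ ≤ K * ‖B x‖ := by
  obtain ⟨φ, κ, hκ, hφ⟩ := hM.exists_functional
  refine ⟨2 * κ⁻¹ * ‖φ‖ + 1, by positivity, fun B x ε hε hB => ?_⟩
  have hφ0 : ∀ z ∈ M, φ z ≠ 0 := fun z hz h => by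
    have := hφ z hz
    rw [h, abs_zero] at this
    have := norm_pos_iff.2 (hM.ne_zero hz)
    nlinarith
  have hball : ∀ y : Plane, ‖y‖ ≤ ε → ‖B y‖ ≤ (2 * κ⁻¹ * ‖φ‖ + 1) * ‖B x‖ := by
    intro y hy
    have hseg : ∀ t : ℝ, |t| ≤ 1 → B x + t • B y ∈ M := by
      intro t ht
      have := hB (x + t • y) (by
        rw [mem_closedBall_iff_norm, add_sub_cancel_left, norm_smul, Real.norm_eq_abs]
        exact (mul_le_of_le_one_left (norm_nonneg y) ht).trans hy)
      rwa [map_add, map_smul] at this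
    have hlt : |φ (B y)| ≤ |φ (B x)| := by
      by_contra! h
      have hv : φ (B y) ≠ 0 := fun h0 => by
        rw [h0, abs_zero] at h
        exact absurd h (abs_nonneg _).not_gt
      -- This parameter puts the point `B x + t • B y` of `M` in the kernel of `φ`.
      refine hφ0 _ (hseg (-(φ (B x) / φ (B y))) ?_) ?_
      · rw [abs_neg, abs_div]
        exact div_le_one_of_le₀ h.le (abs_nonneg _)
      · rw [map_add, map_smul, smul_eq_mul]
        field_simp
        ring
    -- The lower bound for `φ` is applied to `B x + B y`, since `B y` itself need not lie in `M`.
    have h1 := hφ _ (hseg 1 (by simp))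
    rw [one_smul, map_add] at h1
    have h2 : |φ (B x)| ≤ ‖φ‖ * ‖B x‖ := φ.le_opNorm _
    have h3 : ‖B x + B y‖ ≤ 2 * κ⁻¹ * ‖φ‖ * ‖B x‖ := by
      have h4 : κ * ‖B x + B y‖ ≤ 2 * (‖φ‖ * ‖B x‖) := by
        linarith [abs_add_le (φ (B x)) (φ (B y))]
      calc ‖B x + B y‖ = κ⁻¹ * (κ * ‖B x + B y‖) := by field_simp
        _ ≤ κ⁻¹ * (2 * (‖φ‖ * ‖B x‖)) := by gcongr
        _ = _ := by ring
    have h5 : ‖B y‖ ≤ ‖B x + B y‖ + ‖B x‖ := by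
      simpa using norm_sub_le (B x + B y) (B x)
    linarith
  rw [mul_comm, ← le_div_iff₀ hε]
  refine B.opNorm_le_bound (by positivity) fun y => ?_
  rcases eq_or_ne y 0 with rfl | hy
  · simp
  have hy' : 0 < ‖y‖ := norm_pos_iff.2 hy
  have h := hball ((ε / ‖y‖) • y) (by
    rw [norm_smul, Real.norm_of_nonneg (by positivity), div_mul_cancel₀ _ hy'.ne'])
  rw [map_smul, norm_smul, Real.norm_of_nonneg (by positivity), div_mul_eq_mul_div,
    div_le_iff₀ hy'] at h
  rw [div_mul_eq_mul_div, le_div_iff₀ hε]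
  linarith

end Multicone

/-! ### Products along words -/

section Products

theorem cocycleProd_add {Ω : Type*} (T : Ω → Ω) (A : Ω → GL (Fin 2) ℝ) (m n : ℕ) (ω : Ω) :
    cocycleProd T A (m + n) ω = cocycleProd T A m (T^[n] ω) * cocycleProd T A n ω := by
  induction m with
  | zero => simp [cocycleProd]
  | succ m ih =>
    rw [Nat.add_right_comm]
    simp only [cocycleProd, ih, ← Function.iterate_add_apply, mul_assoc]

theorem shift_iterate (k n : ℕ) (ω : ℤ → Fin k) : (shift k)^[n] ω = fun j => ω (j + n) := by
  induction n generalizing ω with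
  | zero => simp
  | succ n ih =>
    rw [Function.iterate_succ_apply, ih]
    funext j
    simp only [shift]
    congr 1
    push_cast
    ring

variable {k : ℕ} (A : Fin k → GL (Fin 2) ℝ)

/-- The product of the first `n` matrices along the word `ω`, as a linear map. -/
def wordMap (n : ℕ) (ω : ℤ → Fin k) : Plane →L[ℝ] Plane :=
  act (cocycleProd (shift k) (oneStep A) n ω)

theorem wordMap_zero (ω : ℤ → Fin k) : wordMap A 0 ω = ContinuousLinearMap.id ℝ Plane := act_one

theorem wordMap_add_apply (m n : ℕ) (ω : ℤ → Fin k) (x : Plane) :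
    wordMap A (m + n) ω x = wordMap A m ((shift k)^[n] ω) (wordMap A n ω x) := by
  rw [wordMap, cocycleProd_add, act_mul_apply]
  rfl

theorem wordMap_one (ω : ℤ → Fin k) : wordMap A 1 ω = act (A (ω 0)) := by
  simp [wordMap, cocycleProd, oneStep]

theorem wordMap_succ_apply (n : ℕ) (ω : ℤ → Fin k) (x : Plane) :
    wordMap A (n + 1) ω x = wordMap A n (shift k ω) (act (A (ω 0)) x) := by
  rw [wordMap_add_apply, wordMap_one]
  rfl

theorem wordMap_ne_zero (n : ℕ) (ω : ℤ → Fin k) {x : Plane} (hx : x ≠ 0) :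
    wordMap A n ω x ≠ 0 :=
  act_ne_zero _ hx

theorem norm_wordMap_pos (n : ℕ) (ω : ℤ → Fin k) : 0 < ‖wordMap A n ω‖ := norm_act_pos _

theorem wordMap_congr (n : ℕ) {ω ω' : ℤ → Fin k} (h : ∀ j : ℕ, j < n → ω j = ω' j) :
    wordMap A n ω = wordMap A n ω' := by
  have : cocycleProd (shift k) (oneStep A) n ω = cocycleProd (shift k) (oneStep A) n ω' := by
    induction n with
    | zero => rfl
    | succ n ih =>
      simp only [cocycleProd, oneStep, shift_iterate, zero_add]
      rw [ih fun j hj => h j (by omega), h n (by omega)]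
  rw [wordMap, this, wordMap]

variable {A} {M : Set Plane}

theorem IsForwardInvariant.act_mem (hinv : IsForwardInvariant A M) (i : Fin k) {x : Plane}
    (hx : x ∈ M) : act (A i) x ∈ M :=
  interior_subset (hinv (Set.mem_iUnion.2 ⟨i, x, hx, rfl⟩))

theorem IsForwardInvariant.wordMap_mem (hinv : IsForwardInvariant A M) (n : ℕ) (ω : ℤ → Fin k)
    {x : Plane} (hx : x ∈ M) : wordMap A n ω x ∈ M := by
  induction n generalizing ω x with
  | zero => simpa [wordMap_zero] using hx
  | succ n ih =>
    rw [wordMap_succ_apply]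
    exact ih _ (hinv.act_mem _ hx)

/-- The images of the unit vectors of `M` form a compact subset of the open set `interior M`, hence
have a uniform margin. -/
theorem exists_closedBall_act_subset (hM : IsMulticone M) (hinv : IsForwardInvariant A M) :
    ∃ δ > (0 : ℝ), ∀ i, ∀ x ∈ M, ‖x‖ = 1 → Metric.closedBall (act (A i) x) δ ⊆ M := by
  have hcomp : IsCompact (⋃ i, act (A i) '' (M ∩ Metric.sphere 0 1)) :=
    isCompact_iUnion fun i => hM.isCompact_inter_sphere.image (act (A i)).continuous
  obtain ⟨δ, hδ, h⟩ := hcomp.exists_cthickening_subset_open isOpen_interior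
    ((Set.iUnion_mono fun i => Set.image_mono Set.inter_subset_left).trans hinv)
  refine ⟨δ, hδ, fun i x hx hx1 => ?_⟩
  refine (Metric.closedBall_subset_cthickening ?_ δ).trans (h.trans interior_subset)
  exact Set.mem_iUnion.2 ⟨i, x, ⟨hx, by simpa using hx1⟩, rfl⟩

/-- Along any word, the vectors of a forward-invariant multicone are expanded almost as much as
any other vector. -/
theorem exists_norm_mul_norm_le (hM : IsMulticone M) (hinv : IsForwardInvariant A M) :
    ∃ c ≥ (1 : ℝ), ∀ n ω, ∀ x ∈ M, ‖wordMap A n ω‖ * ‖x‖ ≤ c * ‖wordMap A n ω x‖ := by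
  obtain ⟨K, hK, hexp⟩ := exists_norm_apply_ge_of_mapsTo hM
  obtain ⟨δ, hδ, hball⟩ := exists_closedBall_act_subset hM hinv
  set a := ∑ i, ‖act (A i)‖
  have ha : ∀ i, ‖act (A i)‖ ≤ a := fun i =>
    Finset.single_le_sum (f := fun i => ‖act (A i)‖) (fun j _ => norm_nonneg _)
      (Finset.mem_univ i)
  have ha0 : 0 ≤ a := Finset.sum_nonneg fun j _ => norm_nonneg _
  refine ⟨a * K / δ + 1, by simp; positivity, fun n ω x hx => ?_⟩
  have hunit : ∀ y ∈ M ∩ Metric.sphere 0 1,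
      ‖wordMap A n ω‖ ≤ (a * K / δ + 1) * ‖wordMap A n ω y‖ := by
    rintro y ⟨hy, hy1⟩
    rw [mem_sphere_zero_iff_norm] at hy1
    -- The first matrix is split off because the uniform ball in `M` is available only after one
    -- step. The remaining factors keep that ball inside `M`.
    cases n with
    | zero =>
      rw [wordMap_zero]
      refine ContinuousLinearMap.norm_id_le.trans ?_
      simp only [ContinuousLinearMap.coe_id', id_eq, hy1, mul_one]
      linarith [show 0 ≤ a * K / δ by positivity]
    | succ n =>
      have h1 : δ * ‖wordMap A n (shift k ω)‖ ≤ K * ‖wordMap A (n + 1) ω y‖ := by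
        rw [wordMap_succ_apply]
        exact hexp _ _ δ hδ fun z hz => hinv.wordMap_mem n _ (hball _ y hy hy1 hz)
      have h2 : ‖wordMap A (n + 1) ω‖ ≤ a * ‖wordMap A n (shift k ω)‖ := by
        refine ContinuousLinearMap.opNorm_le_bound _ (by positivity) fun z => ?_
        rw [wordMap_succ_apply]
        calc _ ≤ ‖wordMap A n (shift k ω)‖ * (‖act (A (ω 0))‖ * ‖z‖) :=
              ContinuousLinearMap.le_opNorm_of_le _ (ContinuousLinearMap.le_opNorm _ _)
          _ ≤ ‖wordMap A n (shift k ω)‖ * (a * ‖z‖) := by gcongr; exact ha _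
          _ = _ := by ring
      calc ‖wordMap A (n + 1) ω‖ ≤ a * ‖wordMap A n (shift k ω)‖ := h2
        _ = a / δ * (δ * ‖wordMap A n (shift k ω)‖) := by field_simp
        _ ≤ a / δ * (K * ‖wordMap A (n + 1) ω y‖) := by gcongr
        _ ≤ _ := by
          have := norm_nonneg (wordMap A (n + 1) ω y)
          rw [add_mul, one_mul]
          have h : a / δ * (K * ‖wordMap A (n + 1) ω y‖) =
            a * K / δ * ‖wordMap A (n + 1) ω y‖ := by ring
          linarith
  have hx0 : 0 < ‖x‖ := norm_pos_iff.2 (hM.ne_zero hx)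
  have h := hunit _ (hM.normalize_mem hx)
  rw [map_smul, norm_smul, norm_inv, norm_norm, mul_left_comm, inv_mul_eq_div,
    le_div_iff₀ hx0] at h
  exact h

theorem exists_abs_log_norm_sub_le (hM : IsMulticone M) (hinv : IsForwardInvariant A M) :
    ∃ K ≥ (0 : ℝ), ∀ n ω, ∀ x ∈ M,
      |Real.log ‖wordMap A n ω x‖ - Real.log ‖wordMap A n ω‖ - Real.log ‖x‖| ≤ K := by
  obtain ⟨c, hc, h⟩ := exists_norm_mul_norm_le hM hinv
  refine ⟨Real.log c, Real.log_nonneg hc, fun n ω x hx => ?_⟩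
  have hx0 : 0 < ‖x‖ := norm_pos_iff.2 (hM.ne_zero hx)
  have hW := norm_wordMap_pos A n ω
  have hWx : 0 < ‖wordMap A n ω x‖ := norm_pos_iff.2 (wordMap_ne_zero A n ω (hM.ne_zero hx))
  have h1 := Real.log_le_log (by positivity) (h n ω x hx)
  have h2 := Real.log_le_log hWx ((wordMap A n ω).le_opNorm x)
  rw [Real.log_mul hW.ne' hx0.ne'] at h1 h2
  rw [Real.log_mul (by positivity) hWx.ne'] at h1
  have := Real.log_nonneg hc
  rw [abs_le]
  constructor <;> linarith

/-- A chord is no longer than its arc; analytically, `1 - θ²/2 ≤ cos θ`. -/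
theorem norm_sub_le_angle {x y : Plane} (hx : ‖x‖ = 1) (hy : ‖y‖ = 1) :
    ‖x - y‖ ≤ InnerProductGeometry.angle x y := by
  refine abs_le_of_sq_le_sq' ?_ (InnerProductGeometry.angle_nonneg x y) |>.2
  have h := InnerProductGeometry.norm_sub_sq_eq_norm_sq_add_norm_sq_sub_two_mul_norm_mul_norm_mul_cos_angle x y
  rw [hx, hy] at h
  nlinarith [Real.one_sub_sq_div_two_le_cos (x := InnerProductGeometry.angle x y)]

/-- For unit vectors, `‖B x - B y‖ ≤ ‖B‖ θ ≤ c ‖B y‖ θ`, so the ratio of the norms is at most `1 + c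
θ`, and `log (1 + c θ) ≤ c θ`. Independence of `n` lets the estimate survive the limit. -/
theorem exists_log_norm_sub_le_lineAngle (hM : IsMulticone M) (hinv : IsForwardInvariant A M) :
    ∃ c > (0 : ℝ), ∀ n ω, ∀ x ∈ M, ∀ y ∈ M,
      |Real.log ‖wordMap A n ω x‖ - Real.log ‖wordMap A n ω y‖| ≤
        c * lineAngle x y + |Real.log ‖x‖ - Real.log ‖y‖| := by
  obtain ⟨c, hc, h⟩ := exists_norm_mul_norm_le hM hinv
  have hpos : ∀ n ω, ∀ x ∈ M, 0 < ‖wordMap A n ω x‖ := fun n ω x hx =>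
    norm_pos_iff.2 (wordMap_ne_zero A n ω (hM.ne_zero hx))
  have hunit : ∀ n ω, ∀ x ∈ M ∩ Metric.sphere 0 1, ∀ y ∈ M ∩ Metric.sphere 0 1,
      Real.log ‖wordMap A n ω x‖ - Real.log ‖wordMap A n ω y‖ ≤
        c * InnerProductGeometry.angle x y := by
    rintro n ω x ⟨hx, hx1⟩ y ⟨hy, hy1⟩
    rw [mem_sphere_zero_iff_norm] at hx1 hy1
    have h1 := h n ω y hy
    rw [hy1, mul_one] at h1
    have hya := hpos n ω y hy
    have hxa := hpos n ω x hx
    have h2 : ‖wordMap A n ω x‖ ≤ ‖wordMap A n ω y‖ * (1 + c * InnerProductGeometry.angle x y) := by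
      have h3 : ‖wordMap A n ω x - wordMap A n ω y‖ ≤
          (c * ‖wordMap A n ω y‖) * InnerProductGeometry.angle x y := by
        rw [← map_sub]
        exact ((wordMap A n ω).le_opNorm _).trans
          (mul_le_mul h1 (norm_sub_le_angle hx1 hy1) (norm_nonneg _) (by positivity))
      have h4 := norm_le_norm_add_norm_sub' (wordMap A n ω x) (wordMap A n ω y)
      linarith
    have hang := InnerProductGeometry.angle_nonneg x y
    have h5 := Real.log_le_log hxa h2
    rw [Real.log_mul hya.ne' (by positivity)] at h5
    have h6 := Real.log_le_sub_one_of_pos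
      (show 0 < 1 + c * InnerProductGeometry.angle x y by positivity)
    linarith
  have hnorm : ∀ n ω, ∀ x ∈ M, Real.log ‖wordMap A n ω (‖x‖⁻¹ • x)‖ =
      Real.log ‖wordMap A n ω x‖ - Real.log ‖x‖ := by
    intro n ω x hx
    have hx0 : 0 < ‖x‖ := norm_pos_iff.2 (hM.ne_zero hx)
    rw [map_smul, norm_smul, norm_inv, norm_norm,
      Real.log_mul (inv_ne_zero hx0.ne') (hpos n ω x hx).ne', Real.log_inv]
    ring
  have hle : ∀ n ω, ∀ x ∈ M, ∀ y ∈ M,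
      Real.log ‖wordMap A n ω x‖ - Real.log ‖wordMap A n ω y‖ ≤
        c * lineAngle x y + |Real.log ‖x‖ - Real.log ‖y‖| := by
    intro n ω x hx y hy
    have hx0 : 0 < ‖x‖ := norm_pos_iff.2 (hM.ne_zero hx)
    have hy0 : 0 < ‖y‖ := norm_pos_iff.2 (hM.ne_zero hy)
    have h1 := hunit n ω _ (hM.normalize_mem hx) _ (hM.normalize_mem hy)
    -- Comparing `x` with both `y` and `-y` turns the angle between vectors into the angle between
    -- lines.
    have hy' : -y ∈ M := by simpa using hM.smul_mem hy (t := -1) (by norm_num)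
    have h2 := hunit n ω _ (hM.normalize_mem hx) _ (hM.normalize_mem hy')
    rw [hnorm n ω x hx, hnorm n ω _ hy, InnerProductGeometry.angle_smul_left_of_pos _ _
      (inv_pos.2 hx0), InnerProductGeometry.angle_smul_right_of_pos _ _ (inv_pos.2 hy0)] at h1
    rw [hnorm n ω x hx, hnorm n ω _ hy', norm_neg, map_neg, norm_neg,
      InnerProductGeometry.angle_smul_left_of_pos _ _ (inv_pos.2 hx0),
      InnerProductGeometry.angle_smul_right_of_pos _ _ (inv_pos.2 hy0),
      InnerProductGeometry.angle_neg_right] at h2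
    have h3 := le_abs_self (Real.log ‖x‖ - Real.log ‖y‖)
    rw [lineAngle, mul_min_of_nonneg _ _ (by linarith)]
    have := le_min h1 h2
    linarith
  refine ⟨c, by linarith, fun n ω x hx y hy => abs_le.2 ⟨?_, hle n ω x hx y hy⟩⟩
  have h1 := hle n ω y hy x hx
  rw [lineAngle, InnerProductGeometry.angle_comm, ← lineAngle, abs_sub_comm] at h1
  linarith

end Products

/-- An almost additive sequence stays at bounded distance from a linear one. -/
theorem exists_abs_sub_mul_le_of_almost_additive {u : ℕ → ℝ} {K : ℝ}
    (h : ∀ m n, |u (m + n) - u m - u n| ≤ K) : ∃ l : ℝ, ∀ n : ℕ, |u n - n * l| ≤ K := by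
  have hK : 0 ≤ K := (abs_nonneg _).trans (h 0 0)
  have hlin : ∀ n : ℕ, |u n| ≤ n * (|u 1| + K) + |u 0| := by
    intro n
    induction n with
    | zero => simp
    | succ n ih =>
      have h1 := abs_le.1 (h n 1)
      have h2 := abs_le.1 ih
      have h3 := abs_le.1 (le_refl |u 1|)
      push_cast
      rw [abs_le]
      constructor <;> linarith
  have hbd : ∀ n : ℕ, ∀ v : ℝ, |v| ≤ |u n| + K → |v / n| ≤ |u 1| + K + |u 0| + K := by
    intro n v hv
    rcases Nat.eq_zero_or_pos n with rfl | hn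
    · simp only [Nat.cast_zero, div_zero, abs_zero]; positivity
    · have hn' : (1 : ℝ) ≤ n := by exact_mod_cast hn
      rw [abs_div, Nat.abs_cast, div_le_iff₀ (by linarith)]
      have := hlin n
      nlinarith [abs_nonneg (u 0)]
  -- Fekete's lemma is applied to `u + K` and to `-u + K`. Their limits are opposite, and since each
  -- is an infimum, each gives one side of the bound.
  have hsub : Subadditive fun n => u n + K := fun m n => by
    have := (abs_le.1 (h m n)).2; linarith
  have hsub' : Subadditive fun n => -u n + K := fun m n => by
    have := (abs_le.1 (h m n)).1; linarith
  have hb : BddBelow (Set.range fun n : ℕ => (u n + K) / n) := by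
    refine ⟨-(|u 1| + K + |u 0| + K), ?_⟩
    rintro _ ⟨n, rfl⟩
    exact (abs_le.1 (hbd n _ ((abs_add_le _ _).trans_eq (by rw [abs_of_nonneg hK])))).1
  have hb' : BddBelow (Set.range fun n : ℕ => (-u n + K) / n) := by
    refine ⟨-(|u 1| + K + |u 0| + K), ?_⟩
    rintro _ ⟨n, rfl⟩
    exact (abs_le.1 (hbd n _ ((abs_add_le _ _).trans_eq (by rw [abs_neg, abs_of_nonneg hK])))).1
  have hlim : hsub'.lim = -hsub.lim := by
    refine tendsto_nhds_unique (hsub'.tendsto_lim hb') ?_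
    have h0 : Tendsto (fun n : ℕ => 2 * K / (n : ℝ)) atTop (𝓝 0) :=
      tendsto_const_div_atTop_nhds_zero_nat _
    have := h0.sub (hsub.tendsto_lim hb)
    rw [zero_sub] at this
    exact this.congr fun n => by ring
  refine ⟨hsub.lim, fun n => ?_⟩
  rcases Nat.eq_zero_or_pos n with rfl | hn
  · have := h 0 0
    simp only [add_zero, sub_self, zero_sub, abs_neg] at this
    simpa using this
  · have hn' : (0 : ℝ) < n := by exact_mod_cast hn
    have h1 := hsub.lim_le_div hb hn.ne'
    have h2 := hsub'.lim_le_div hb' hn.ne'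
    rw [le_div_iff₀ hn'] at h1 h2
    rw [hlim] at h2
    rw [abs_le]
    constructor <;> linarith

/-! ### Maximal growth over words of given length -/

section WordMax

variable {k : ℕ} [NeZero k] (A : Fin k → GL (Fin 2) ℝ) (σ : ℝ)

/-- The maximum of `σ * log ‖B x‖` over all products `B` of `n` of the matrices. -/
def wordMax : ℕ → Plane → ℝ
  | 0, x => σ * Real.log ‖x‖
  | n + 1, x => Finset.univ.sup' Finset.univ_nonempty fun i => wordMax n (act (A i) x)

theorem wordMax_act_le (n : ℕ) (x : Plane) (i : Fin k) :
    wordMax A σ n (act (A i) x) ≤ wordMax A σ (n + 1) x :=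
  Finset.le_sup' (fun i => wordMax A σ n (act (A i) x)) (Finset.mem_univ i)

theorem exists_wordMax_succ_eq (n : ℕ) (x : Plane) :
    ∃ i, wordMax A σ (n + 1) x = wordMax A σ n (act (A i) x) := by
  obtain ⟨i, -, hi⟩ := Finset.exists_mem_eq_sup' Finset.univ_nonempty
    fun i => wordMax A σ n (act (A i) x)
  exact ⟨i, hi⟩

theorem le_wordMax (n : ℕ) (ω : ℤ → Fin k) (x : Plane) :
    σ * Real.log ‖wordMap A n ω x‖ ≤ wordMax A σ n x := by
  induction n generalizing ω x with
  | zero => simp [wordMap_zero, wordMax]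
  | succ n ih =>
    rw [wordMap_succ_apply]
    exact (ih _ _).trans (wordMax_act_le A σ n x _)

theorem exists_wordMax_eq (n : ℕ) (x : Plane) :
    ∃ ω, wordMax A σ n x = σ * Real.log ‖wordMap A n ω x‖ := by
  induction n generalizing x with
  | zero => exact ⟨fun _ => 0, by simp [wordMap_zero, wordMax]⟩
  | succ n ih =>
    obtain ⟨i, hi⟩ := exists_wordMax_succ_eq A σ n x
    obtain ⟨ω, hω⟩ := ih (act (A i) x)
    refine ⟨fun j => if j = 0 then i else ω (j - 1), ?_⟩
    rw [hi, hω, wordMap_succ_apply, if_pos rfl]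
    congr 4
    refine wordMap_congr A n fun j _ => ?_
    have : ((j : ℤ) + 1) ≠ 0 := by omega
    simp [shift, this]

theorem wordMax_smul (n : ℕ) {x : Plane} (hx : x ≠ 0) {t : ℝ} (ht : t ≠ 0) :
    wordMax A σ n (t • x) = wordMax A σ n x + σ * Real.log |t| := by
  induction n generalizing x with
  | zero =>
    simp only [wordMax, norm_smul, Real.norm_eq_abs]
    rw [Real.log_mul (abs_ne_zero.2 ht) (norm_ne_zero_iff.2 hx)]
    ring
  | succ n ih =>
    simp only [map_smul, wordMax, ih (act_ne_zero _ hx)]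
    exact (Finset.apply_sup'_eq_sup'_comp Finset.univ_nonempty
      (fun r : ℝ => r + σ * Real.log |t|) fun a b => max_add_add_right a b _ |>.symm).symm

variable {A σ}

theorem wordMax_sub_le {n : ℕ} {x y : Plane} {D : ℝ}
    (h : ∀ ω, σ * Real.log ‖wordMap A n ω x‖ - σ * Real.log ‖wordMap A n ω y‖ ≤ D) :
    wordMax A σ n x - wordMax A σ n y ≤ D := by
  obtain ⟨ω, hω⟩ := exists_wordMax_eq A σ n x
  have h1 := h ω
  have h2 := le_wordMax A σ n ω y
  linarith

variable {M : Set Plane}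

theorem wordMax_add_le (hinv : IsForwardInvariant A M) {m : ℕ} {a : ℝ}
    (h : ∀ x ∈ M, wordMax A σ m x ≤ σ * Real.log ‖x‖ + a) (n : ℕ) :
    ∀ x ∈ M, wordMax A σ (n + m) x ≤ wordMax A σ n x + a := by
  induction n with
  | zero => simpa [wordMax] using h
  | succ n ih =>
    intro x hx
    rw [Nat.add_right_comm]
    obtain ⟨i, hi⟩ := exists_wordMax_succ_eq A σ (n + m) x
    have h1 := ih _ (hinv.act_mem i hx)
    have h2 := wordMax_act_le A σ n x i
    linarith

theorem le_wordMax_add (hinv : IsForwardInvariant A M) {m : ℕ} {a : ℝ}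
    (h : ∀ x ∈ M, σ * Real.log ‖x‖ + a ≤ wordMax A σ m x) (n : ℕ) :
    ∀ x ∈ M, wordMax A σ n x + a ≤ wordMax A σ (n + m) x := by
  induction n with
  | zero => simpa [wordMax] using h
  | succ n ih =>
    intro x hx
    rw [Nat.add_right_comm n 1 m]
    obtain ⟨i, hi⟩ := exists_wordMax_succ_eq A σ n x
    have h1 := ih _ (hinv.act_mem i hx)
    have h2 := wordMax_act_le A σ (n + m) x i
    linarith

/-- Up to `σ log ‖x‖`, replacing `x` by a fixed unit vector `x₀` changes the maximum by at most
`2K`. Cutting words in two then shows that the values at `x₀` are almost additive in `n`. -/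
theorem exists_abs_wordMax_sub_le (hM : IsMulticone M) (hinv : IsForwardInvariant A M)
    (hσ : |σ| = 1) :
    ∃ l : ℝ, ∃ K ≥ (0 : ℝ), ∀ n : ℕ, ∀ x ∈ M,
      |wordMax A σ n x - σ * Real.log ‖x‖ - n * l| ≤ K := by
  obtain ⟨K, hK, hlog⟩ := exists_abs_log_norm_sub_le hM hinv
  obtain ⟨x, hx⟩ := hM.nonempty
  obtain ⟨x₀, hx₀, hx₀1⟩ : ∃ x₀ ∈ M, ‖x₀‖ = 1 :=
    ⟨_, (hM.normalize_mem hx).1, by simpa using (hM.normalize_mem hx).2⟩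
  have hcomp : ∀ n, ∀ x ∈ M,
      |wordMax A σ n x - σ * Real.log ‖x‖ - wordMax A σ n x₀| ≤ 2 * K := by
    intro n x hx
    have key : ∀ ω, |σ * Real.log ‖wordMap A n ω x‖ - σ * Real.log ‖wordMap A n ω x₀‖ -
        σ * Real.log ‖x‖| ≤ 2 * K := by
      intro ω
      have h1 := hlog n ω x hx
      have h2 := hlog n ω x₀ hx₀
      rw [hx₀1, Real.log_one, sub_zero] at h2
      rw [← mul_sub, ← mul_sub, abs_mul, hσ, one_mul]
      rw [abs_le] at *
      constructor <;> linarith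
    have h1 := wordMax_sub_le (A := A) (σ := σ) (n := n) (x := x) (y := x₀)
      (D := 2 * K + σ * Real.log ‖x‖) fun ω => by linarith [(abs_le.1 (key ω)).2]
    have h2 := wordMax_sub_le (A := A) (σ := σ) (n := n) (x := x₀) (y := x)
      (D := 2 * K - σ * Real.log ‖x‖) fun ω => by linarith [(abs_le.1 (key ω)).1]
    rw [abs_le]
    constructor <;> linarith
  obtain ⟨l, hl⟩ := exists_abs_sub_mul_le_of_almost_additive
    (u := fun n => wordMax A σ n x₀) (K := 2 * K) fun n m => by
      have h1 := wordMax_add_le hinv (σ := σ) (m := m) (a := wordMax A σ m x₀ + 2 * K)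
        (fun y hy => by linarith [(abs_le.1 (hcomp m y hy)).2]) n x₀ hx₀
      have h2 := le_wordMax_add hinv (σ := σ) (m := m) (a := wordMax A σ m x₀ - 2 * K)
        (fun y hy => by linarith [(abs_le.1 (hcomp m y hy)).1]) n x₀ hx₀
      rw [abs_le]
      constructor <;> linarith
  refine ⟨l, 4 * K, by positivity, fun n x hx => ?_⟩
  have h1 := abs_le.1 (hcomp n x hx)
  have h2 := abs_le.1 (hl n)
  rw [abs_le]
  constructor <;> linarith

theorem abs_wordMax_sub_le_lineAngle (hM : IsMulticone M) (hinv : IsForwardInvariant A M)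
    (hσ : |σ| = 1) :
    ∃ c > (0 : ℝ), ∀ n, ∀ x ∈ M, ∀ y ∈ M, |wordMax A σ n x - wordMax A σ n y| ≤
      c * lineAngle x y + |Real.log ‖x‖ - Real.log ‖y‖| := by
  obtain ⟨c, hc, h⟩ := exists_log_norm_sub_le_lineAngle hM hinv
  refine ⟨c, hc, fun n x hx y hy => ?_⟩
  have key : ∀ ω, |σ * Real.log ‖wordMap A n ω x‖ - σ * Real.log ‖wordMap A n ω y‖| ≤
      c * lineAngle x y + |Real.log ‖x‖ - Real.log ‖y‖| := fun ω => by
    rw [← mul_sub, abs_mul, hσ, one_mul]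
    exact h n ω x hx y hy
  exact abs_sub_le_iff.2 ⟨wordMax_sub_le fun ω => (abs_sub_le_iff.1 (key ω)).1,
    wordMax_sub_le fun ω => (abs_sub_le_iff.1 (key ω)).2⟩

end WordMax

/-! ### The extremal function -/

section Extremal

variable {k : ℕ} [NeZero k] {A : Fin k → GL (Fin 2) ℝ} {σ : ℝ} {M : Set Plane}

/-- The limit function of the normalized maxima over all products of length `n`. -/
def extremalFn (A : Fin k → GL (Fin 2) ℝ) (σ l : ℝ) (x : Plane) : ℝ :=
  limsup (fun n : ℕ => wordMax A σ n x - n * l) atTop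

variable {l K : ℝ} (hK : ∀ n : ℕ, ∀ x ∈ M, |wordMax A σ n x - σ * Real.log ‖x‖ - n * l| ≤ K)

include hK

theorem isBoundedUnder_le_wordMax {x : Plane} (hx : x ∈ M) :
    IsBoundedUnder (· ≤ ·) atTop fun n : ℕ => wordMax A σ n x - n * l :=
  isBoundedUnder_of ⟨σ * Real.log ‖x‖ + K, fun n => by linarith [(abs_le.1 (hK n x hx)).2]⟩

theorem isCoboundedUnder_le_wordMax {x : Plane} (hx : x ∈ M) :
    IsCoboundedUnder (· ≤ ·) atTop fun n : ℕ => wordMax A σ n x - n * l :=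
  IsBoundedUnder.isCoboundedUnder_le
    (isBoundedUnder_of ⟨σ * Real.log ‖x‖ - K, fun n => by linarith [(abs_le.1 (hK n x hx)).1]⟩)

theorem extremalFn_sub_le {x y : Plane} (hx : x ∈ M) (hy : y ∈ M) {D : ℝ}
    (h : ∀ n, wordMax A σ n x ≤ wordMax A σ n y + D) :
    extremalFn A σ l x ≤ extremalFn A σ l y + D := by
  rw [extremalFn, extremalFn, ← limsup_add_const atTop _ D (isBoundedUnder_le_wordMax hK hy)
    (isCoboundedUnder_le_wordMax hK hy)]
  refine limsup_le_limsup (Eventually.of_forall fun n => by linarith [h n])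
    (isCoboundedUnder_le_wordMax hK hx) ?_
  exact isBoundedUnder_of ⟨σ * Real.log ‖y‖ + K + D, fun n => by
    linarith [(abs_le.1 (hK n y hy)).2]⟩

theorem extremalFn_smul (hM : IsMulticone M) {x : Plane} (hx : x ∈ M) {t : ℝ} (ht : t ≠ 0) :
    extremalFn A σ l (t • x) = extremalFn A σ l x + σ * Real.log |t| := by
  have h := fun n => wordMax_smul A σ n (hM.ne_zero hx) ht
  refine le_antisymm (extremalFn_sub_le hK (hM.smul_mem hx ht) hx fun n => (h n).le) ?_
  have := extremalFn_sub_le hK (D := -(σ * Real.log |t|)) hx (hM.smul_mem hx ht) fun n => by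
    linarith [h n]
  linarith

theorem isGreatest_extremalFn (hinv : IsForwardInvariant A M) {x : Plane} (hx : x ∈ M) :
    IsGreatest (Set.range fun i : Fin k => extremalFn A σ l (act (A i) x))
      (extremalFn A σ l x + l) := by
  have hsup : extremalFn A σ l x + l =
      Finset.univ.sup' Finset.univ_nonempty fun i : Fin k => extremalFn A σ l (act (A i) x) := by
    simp only [extremalFn]
    rw [← limsup_finset_sup' (F := fun (i : Fin k) (n : ℕ) => wordMax A σ n (act (A i) x) - n * l)
        Finset.univ_nonempty
        (fun i _ => isCoboundedUnder_le_wordMax hK (hinv.act_mem i hx))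
        (fun i _ => isBoundedUnder_le_wordMax hK (hinv.act_mem i hx)),
      -- The index shift by one aligns length `n + 1` at `x` with length `n` at the images `A_i x`;
      -- normalizing by `(n + 1) l` instead of `n l` produces the extra `l`.
      ← limsup_nat_add (fun n : ℕ => wordMax A σ n x - n * l) 1,
      ← limsup_add_const atTop _ l]
    · congr 1
      funext n
      have := Finset.apply_sup'_eq_sup'_comp (s := (Finset.univ : Finset (Fin k)))
        Finset.univ_nonempty (f := fun i => wordMax A σ n (act (A i) x))
        (fun r : ℝ => r - n * l) fun a b => max_sub_sub_right a b _ |>.symm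
      simp only [Function.comp_def] at this
      rw [← this]
      push_cast
      simp only [wordMax]
      ring
    · exact isBoundedUnder_of ⟨σ * Real.log ‖x‖ + K, fun n => by
        linarith [(abs_le.1 (hK (n + 1) x hx)).2]⟩
    · exact IsBoundedUnder.isCoboundedUnder_le (isBoundedUnder_of
        ⟨σ * Real.log ‖x‖ - K, fun n => by linarith [(abs_le.1 (hK (n + 1) x hx)).1]⟩)
  constructor
  · obtain ⟨i, -, hi⟩ := Finset.exists_mem_eq_sup' Finset.univ_nonempty
      fun i : Fin k => extremalFn A σ l (act (A i) x)
    exact ⟨i, by rw [hsup, hi]⟩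
  · rintro _ ⟨i, rfl⟩
    rw [hsup]
    exact Finset.le_sup' (fun i => extremalFn A σ l (act (A i) x)) (Finset.mem_univ i)

end Extremal

/-! ### Upper limits of linearly bounded sequences -/

section Limsup

variable {v : ℕ → ℝ} {C a D : ℝ}

theorem abs_one_div_mul_le (hv : ∀ n, |v n| ≤ n * C) (n : ℕ) : |1 / (n : ℝ) * v n| ≤ |C| := by
  rcases Nat.eq_zero_or_pos n with rfl | hn
  · simp
  · have hn' : (0 : ℝ) < n := by exact_mod_cast hn
    rw [abs_mul, abs_of_pos (by positivity), one_div, inv_mul_le_iff₀ hn']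
    exact (hv n).trans (by gcongr; exact le_abs_self C)

/-- The bound `hv` only keeps the averages bounded, without which a real `limsup` may take a default
value. -/
theorem limsup_one_div_mul_le (hv : ∀ n, |v n| ≤ n * C) (h : ∀ n : ℕ, v n ≤ n * a + D) :
    limsup (fun n : ℕ => 1 / (n : ℝ) * v n) atTop ≤ a := by
  have hlim : Tendsto (fun n : ℕ => a + D / n) atTop (𝓝 (a + 0)) :=
    tendsto_const_nhds.add (tendsto_const_div_atTop_nhds_zero_nat D)
  rw [add_zero] at hlim
  rw [← hlim.limsup_eq]
  refine limsup_le_limsup ?_ ?_ hlim.isBoundedUnder_le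
  · filter_upwards [eventually_gt_atTop 0] with n hn
    have hn' : (0 : ℝ) < n := by exact_mod_cast hn
    rw [one_div, inv_mul_le_iff₀ hn', mul_add, mul_div_cancel₀ _ hn'.ne']
    exact h n
  · exact IsBoundedUnder.isCoboundedUnder_le
      (isBoundedUnder_of ⟨-|C|, fun n => (abs_le.1 (abs_one_div_mul_le hv n)).1⟩)

theorem le_limsup_one_div_mul (hv : ∀ n, |v n| ≤ n * C) (h : ∀ n : ℕ, n * a - D ≤ v n) :
    a ≤ limsup (fun n : ℕ => 1 / (n : ℝ) * v n) atTop := by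
  have hlim : Tendsto (fun n : ℕ => a - D / n) atTop (𝓝 (a - 0)) :=
    tendsto_const_nhds.sub (tendsto_const_div_atTop_nhds_zero_nat D)
  rw [sub_zero] at hlim
  rw [← hlim.limsup_eq]
  refine limsup_le_limsup ?_ hlim.isBoundedUnder_ge.isCoboundedUnder_le
    (isBoundedUnder_of ⟨|C|, fun n => (abs_le.1 (abs_one_div_mul_le hv n)).2⟩)
  filter_upwards [eventually_gt_atTop 0] with n hn
  have hn' : (0 : ℝ) < n := by exact_mod_cast hn
  rw [one_div, le_inv_mul_iff₀ hn', mul_sub, mul_div_cancel₀ _ hn'.ne']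
  exact h n

end Limsup

/-! ### Growth along periodic orbits and orbit measures -/

section PeriodicOrbits

variable {Ω : Type*} {T : Ω → Ω}

/-- Each period contributes at least `N l - K` and each concatenation costs another `K`, so the rate
drops by at most `2K/N`. A general stretch of the orbit is completed to whole periods by a head of
length `j` and a tail of length `r`, whose contributions `hub` bounds above. -/
theorem exists_le_along_periodic_orbit {b : ℕ → Ω → ℝ} {K l : ℝ}
    (hadd : ∀ m n ω, |b (m + n) ω - b m (T^[n] ω) - b n ω| ≤ K)
    (hub : ∀ n ω, b n ω ≤ n * l + K) (hb0 : ∀ ω, b 0 ω = 0) {N : ℕ} (hN : 0 < N) {ω : Ω}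
    (hω : T^[N] ω = ω) (hbN : N * l - K ≤ b N ω) (j : ℕ) :
    ∃ D, ∀ n : ℕ, n * (l - 2 * K / N) - D ≤ b n (T^[j] ω) := by
  have hK : 0 ≤ K := (abs_nonneg _).trans (hadd 0 0 ω)
  have hN' : (0 : ℝ) < N := by exact_mod_cast hN
  have hmul : ∀ m : ℕ, m * (N * l) - 2 * m * K ≤ b (m * N) ω := by
    intro m
    induction m with
    | zero => simp [hb0]
    | succ m ih =>
      have h1 := (abs_le.1 (hadd (m * N) N ω)).1
      rw [hω, ← Nat.succ_mul] at h1
      rw [← Nat.succ_eq_add_one]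
      push_cast
      linarith
  -- The number `m` of periods exceeds `n / N` by at most `j / N + 1`. The `4 * K` comes from two
  -- cuts and from the upper bounds on head and tail.
  refine ⟨2 * K * (j / N + 1) + 4 * K, fun n => ?_⟩
  obtain ⟨m, hm, hm'⟩ : ∃ m : ℕ, n + j ≤ m * N ∧ m * N ≤ n + j + N := by
    refine ⟨(n + j) / N + 1, ?_, ?_⟩
    · rw [add_mul, one_mul, mul_comm]
      have := Nat.div_add_mod (n + j) N
      have := Nat.mod_lt (n + j) hN
      omega
    · rw [add_mul, one_mul]
      gcongr
      exact Nat.div_mul_le_self _ _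
  obtain ⟨r, hr⟩ := Nat.exists_eq_add_of_le hm
  have h1 := hmul m
  have h2 := (abs_le.1 (hadd r (n + j) ω)).2
  have h3 := (abs_le.1 (hadd n j ω)).2
  rw [add_comm r, ← hr] at h2
  have h4 := hub r (T^[n + j] ω)
  have h5 := hub j ω
  have hr' : (m : ℝ) * N = n + j + r := by exact_mod_cast hr
  have hmN : (m : ℝ) ≤ n / N + (j / N + 1) := by
    have : (m : ℝ) * N ≤ n + j + N := by exact_mod_cast hm'
    rw [← le_div_iff₀ hN'] at this
    refine this.trans_eq ?_
    field_simp
    ring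
  have h6 : 2 * K * m ≤ 2 * K * (n / N + (j / N + 1)) := by gcongr
  have h7 : (n : ℝ) * (l - 2 * K / N) = n * l - 2 * K * (n / N) := by ring
  have h8 : (m : ℝ) * (N * l) = n * l + j * l + r * l := by rw [← mul_assoc, hr']; ring
  rw [h7]
  linarith

variable [MeasurableSpace Ω]

/-- The uniform distribution on `ω, T ω, …, T^{n-1} ω`. -/
def orbitMeasure (T : Ω → Ω) (n : ℕ) (ω : Ω) : Measure Ω :=
  (n : ENNReal)⁻¹ • ∑ j ∈ Finset.range n, Measure.dirac (T^[j] ω)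

theorem orbitMeasure_mem_invariantMeasures (hT : Measurable T) {n : ℕ} (hn : 0 < n) {ω : Ω}
    (hω : T^[n] ω = ω) : orbitMeasure T n ω ∈ invariantMeasures T := by
  refine ⟨⟨?_⟩, ⟨hT, ?_⟩⟩
  · simp only [orbitMeasure, Measure.smul_apply, Measure.finsetSum_apply, measure_univ,
      Finset.sum_const, Finset.card_range, smul_eq_mul, nsmul_eq_mul, mul_one]
    exact ENNReal.inv_mul_cancel (by exact_mod_cast hn.ne') (ENNReal.natCast_ne_top n)
  · obtain ⟨n, rfl⟩ := Nat.exists_eq_add_of_lt hn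
    simp only [zero_add] at *
    rw [orbitMeasure, Measure.map_smul, Measure.map_finset_sum hT.aemeasurable]
    congr 1
    -- Pushing forward rotates the sum: periodicity turns its last term into the former first one.
    rw [Finset.sum_range_succ, Finset.sum_range_succ']
    simp only [Measure.map_dirac' hT, ← Function.iterate_succ_apply' T, hω, Function.iterate_zero,
      id]

theorem ae_orbitMeasure {p : Ω → Prop} (hp : MeasurableSet {ω | p ω}) {n : ℕ} {ω : Ω}
    (h : ∀ j, p (T^[j] ω)) : ∀ᵐ x ∂orbitMeasure T n ω, p x := by
  refine Measure.ae_smul_measure ?_ _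
  rw [ae_finsetSum_measure_iff]
  exact fun j _ => (ae_dirac_iff hp).2 (h j)

end PeriodicOrbits

/-! ### Lyapunov exponents of the one-step cocycle -/

section OneStepLyapunov

variable {k : ℕ} {A : Fin k → GL (Fin 2) ℝ} {σ : ℝ} {M : Set Plane}

theorem exists_abs_log_norm_wordMap_add_le (hM : IsMulticone M) (hinv : IsForwardInvariant A M) :
    ∃ K ≥ (0 : ℝ), ∀ m n ω, |Real.log ‖wordMap A (m + n) ω‖ -
      Real.log ‖wordMap A m ((shift k)^[n] ω)‖ - Real.log ‖wordMap A n ω‖| ≤ K := by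
  obtain ⟨K, hK, h⟩ := exists_abs_log_norm_sub_le hM hinv
  obtain ⟨x, hx⟩ := hM.nonempty
  refine ⟨3 * K, by positivity, fun m n ω => ?_⟩
  have h1 := h (m + n) ω x hx
  have h2 := h m ((shift k)^[n] ω) _ (hinv.wordMap_mem n ω hx)
  have h3 := h n ω x hx
  rw [wordMap_add_apply] at h1
  rw [abs_le] at *
  constructor <;> linarith

theorem exists_abs_log_norm_wordMap_le (hM : IsMulticone M) (hinv : IsForwardInvariant A M) :
    ∃ C, ∀ n ω, |Real.log ‖wordMap A n ω‖| ≤ n * C := by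
  obtain ⟨K, hK, h⟩ := exists_abs_log_norm_wordMap_add_le hM hinv
  refine ⟨∑ i, |Real.log ‖act (A i)‖| + K, fun n ω => ?_⟩
  induction n generalizing ω with
  | zero => simp [wordMap_zero]
  | succ n ih =>
    have h1 := h n 1 ω
    have h2 := ih ((shift k)^[1] ω)
    have h3 : |Real.log ‖wordMap A 1 ω‖| ≤ ∑ i, |Real.log ‖act (A i)‖| := by
      rw [wordMap_one]
      exact Finset.single_le_sum (f := fun i => |Real.log ‖act (A i)‖|)
        (fun j _ => abs_nonneg _) (Finset.mem_univ (ω 0))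
    push_cast
    rw [abs_le] at *
    constructor <;> linarith

theorem measurable_shift : Measurable (shift k) :=
  measurable_pi_lambda _ fun n => measurable_pi_apply (n + 1)

theorem mul_lyapunovAt_le {C a D : ℝ} {ω : ℤ → Fin k} (hσ : |σ| = 1)
    (hC : ∀ n, |Real.log ‖wordMap A n ω‖| ≤ n * C)
    (h : ∀ n : ℕ, σ * Real.log ‖wordMap A n ω‖ ≤ n * a + D) :
    σ * lyapunovAt (shift k) (oneStep A) ω ≤ a := by
  rcases eq_or_eq_neg_of_abs_eq hσ with rfl | rfl
  · rw [one_mul]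
    exact limsup_one_div_mul_le hC fun n => by simpa [wordMap] using h n
  · have : -a ≤ lyapunovAt (shift k) (oneStep A) ω :=
      le_limsup_one_div_mul (v := fun n => Real.log ‖wordMap A n ω‖) hC (D := D)
        fun n => by linarith [h n]
    linarith

theorem le_mul_lyapunovAt {C a D : ℝ} {ω : ℤ → Fin k} (hσ : |σ| = 1)
    (hC : ∀ n, |Real.log ‖wordMap A n ω‖| ≤ n * C)
    (h : ∀ n : ℕ, n * a - D ≤ σ * Real.log ‖wordMap A n ω‖) :
    a ≤ σ * lyapunovAt (shift k) (oneStep A) ω := by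
  have := mul_lyapunovAt_le (σ := -σ) (a := -a) (D := D) (by rwa [abs_neg]) hC
    fun n => by linarith [h n]
  linarith

variable [NeZero k]

theorem measurable_log_norm_wordMap (n : ℕ) :
    Measurable fun ω => Real.log ‖wordMap A n ω‖ := by
  -- The product depends only on the letters `0, …, n-1`, so the function factors through a finite
  -- type; the letters chosen elsewhere are irrelevant.
  let extend : (Fin n → Fin k) → ℤ → Fin k := fun w j =>
    if h : j.toNat < n then w ⟨j.toNat, h⟩ else 0
  have heq : (fun ω => Real.log ‖wordMap A n ω‖) =
      (fun w => Real.log ‖wordMap A n (extend w)‖) ∘ fun ω (j : Fin n) => ω (j : ℕ) := by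
    funext ω
    simp only [Function.comp_def]
    rw [wordMap_congr A n (ω' := extend fun j : Fin n => ω (j : ℕ))]
    intro j hj
    simp [extend, hj]
  rw [heq]
  exact (measurable_of_finite _).comp (measurable_pi_lambda _ fun j => measurable_pi_apply _)

theorem measurable_lyapunovAt : Measurable (lyapunovAt (shift k) (oneStep A)) :=
  Measurable.limsup fun n => (measurable_log_norm_wordMap n).const_mul _

theorem integrable_lyapunovAt {C : ℝ} (hC : ∀ n ω, |Real.log ‖wordMap A n ω‖| ≤ n * C)
    (μ : Measure (ℤ → Fin k)) [IsProbabilityMeasure μ] :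
    Integrable (lyapunovAt (shift k) (oneStep A)) μ := by
  refine Integrable.of_bound measurable_lyapunovAt.aestronglyMeasurable C
    (Eventually.of_forall fun ω => ?_)
  rw [Real.norm_eq_abs, abs_le]
  have h1 := mul_lyapunovAt_le (σ := 1) (a := C) (D := 0) (by simp) (fun n => hC n ω)
    fun n => by linarith [(abs_le.1 (hC n ω)).2]
  have h2 := le_mul_lyapunovAt (σ := 1) (a := -C) (D := 0) (by simp) (fun n => hC n ω)
    fun n => by linarith [(abs_le.1 (hC n ω)).1]
  constructor <;> linarith

/-- A periodic word along which the growth of the matrix products is nearly extremal. -/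
theorem exists_periodic_wordMax_eq (A : Fin k → GL (Fin 2) ℝ) (σ : ℝ) (N : ℕ) (x : Plane) :
    ∃ ω, (shift k)^[N] ω = ω ∧
      wordMax A σ N x = σ * Real.log ‖wordMap A N ω x‖ := by
  obtain ⟨ω, hω⟩ := exists_wordMax_eq A σ N x
  -- The first `N` letters are repeated periodically. For `N = 0` this is `ω` itself, since `j % 0 =
  -- j`.
  refine ⟨fun j => ω (j % N), ?_, ?_⟩
  · rw [shift_iterate]
    funext j
    simp
  · rw [hω, wordMap_congr A N]
    intro j hj
    congr 1
    exact (Int.emod_eq_of_lt (by omega) (by exact_mod_cast hj)).symm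

/-- The sign `σ` treats both extremal problems at once. The first two clauses say that `l` is the
supremum of `σ λ₁(μ)`. -/
theorem exists_extremal (hM : IsMulticone M) (hinv : IsForwardInvariant A M) (hσ : |σ| = 1) :
    ∃ (l : ℝ) (p : Plane → ℝ),
      (∀ μ ∈ invariantMeasures (shift k), σ * lyapunov (shift k) (oneStep A) μ ≤ l) ∧
      (∀ ε > 0, ∃ μ ∈ invariantMeasures (shift k),
        l - ε < σ * lyapunov (shift k) (oneStep A) μ) ∧
      (∀ x ∈ M, IsGreatest (Set.range fun i : Fin k => p (act (A i) x)) (p x + l)) ∧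
      (∀ x ∈ M, ∀ t : ℝ, t ≠ 0 → p (t • x) = p x + σ * Real.log |t|) ∧
      ∃ c > (0 : ℝ), ∀ x ∈ M, ∀ y ∈ M,
        |p x - p y| ≤ c * lineAngle x y + |Real.log ‖x‖ - Real.log ‖y‖| := by
  obtain ⟨l, K₁, hK₁0, hK₁⟩ := exists_abs_wordMax_sub_le hM hinv hσ
  obtain ⟨K₂, hK₂0, hK₂⟩ := exists_abs_log_norm_wordMap_add_le hM hinv
  obtain ⟨K₃, hK₃0, hK₃⟩ := exists_abs_log_norm_sub_le hM hinv
  obtain ⟨C, hC⟩ := exists_abs_log_norm_wordMap_le hM hinv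
  obtain ⟨c, hc, hreg⟩ := abs_wordMax_sub_le_lineAngle hM hinv hσ
  obtain ⟨x, hx⟩ := hM.nonempty
  set K := K₁ + K₂ + K₃
  have habs : ∀ r : ℝ, |σ * r| = |r| := fun r => by rw [abs_mul, hσ, one_mul]
  have hσK₃ : ∀ n ω, |σ * Real.log ‖wordMap A n ω x‖ - σ * Real.log ‖wordMap A n ω‖ -
      σ * Real.log ‖x‖| ≤ K₃ := fun n ω => by
    rw [← mul_sub, ← mul_sub, habs]
    exact hK₃ n ω x hx
  have hadd : ∀ m n ω, |σ * Real.log ‖wordMap A (m + n) ω‖ -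
      σ * Real.log ‖wordMap A m ((shift k)^[n] ω)‖ - σ * Real.log ‖wordMap A n ω‖| ≤ K := by
    intro m n ω
    rw [← mul_sub, ← mul_sub, habs]
    exact (hK₂ m n ω).trans (by simp only [K]; linarith)
  have hub : ∀ n ω, σ * Real.log ‖wordMap A n ω‖ ≤ n * l + K := by
    intro n ω
    have h1 := (abs_le.1 (hK₁ n x hx)).2
    have h2 := (abs_le.1 (hσK₃ n ω)).1
    have h3 := le_wordMax A σ n ω x
    simp only [K]
    linarith
  refine ⟨l, extremalFn A σ l, ?_, ?_, fun x hx => isGreatest_extremalFn hK₁ hinv hx,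
    fun x hx t ht => extremalFn_smul hK₁ hM hx ht, c, hc, fun x hx y hy => ?_⟩
  · rintro μ ⟨hμ, -⟩
    rw [lyapunov, ← integral_const_mul]
    refine (integral_mono ((integrable_lyapunovAt hC μ).const_mul σ) (integrable_const l)
      fun ω => mul_lyapunovAt_le hσ (fun n => hC n ω) fun n => hub n ω).trans_eq ?_
    simp
  · intro ε hε
    -- This makes the loss `2K/N` of the periodic word smaller than `ε`.
    obtain ⟨N, hN⟩ := exists_nat_gt (2 * K / ε)
    have hN' : (0 : ℝ) < N := lt_of_le_of_lt (by positivity) hN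
    have hN0 : 0 < N := by exact_mod_cast hN'
    obtain ⟨ω, hper, hω⟩ := exists_periodic_wordMax_eq A σ N x
    have hmem := orbitMeasure_mem_invariantMeasures measurable_shift hN0 hper
    have hprob := hmem.1
    refine ⟨_, hmem, ?_⟩
    have hbN : N * l - K ≤ σ * Real.log ‖wordMap A N ω‖ := by
      have h1 := (abs_le.1 (hK₁ N x hx)).1
      have h2 := (abs_le.1 (hσK₃ N ω)).2
      simp only [K]
      linarith
    have hlow : ∀ j, l - 2 * K / N ≤ σ * lyapunovAt (shift k) (oneStep A) ((shift k)^[j] ω) := by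
      intro j
      obtain ⟨D, hD⟩ := exists_le_along_periodic_orbit
        (b := fun n ω => σ * Real.log ‖wordMap A n ω‖) hadd hub
        (fun ω => by simp [wordMap_zero]) hN0 hper hbN j
      exact le_mul_lyapunovAt hσ (fun n => hC n _) hD
    have hae : ∀ᵐ ξ ∂orbitMeasure (shift k) N ω,
        l - 2 * K / N ≤ σ * lyapunovAt (shift k) (oneStep A) ξ :=
      ae_orbitMeasure (measurableSet_le measurable_const (measurable_lyapunovAt.const_mul σ)) hlow
    have hint := integral_mono_ae (integrable_const _)
      ((integrable_lyapunovAt hC (orbitMeasure (shift k) N ω)).const_mul σ) hae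
    rw [integral_const_mul, integral_const, probReal_univ, one_smul] at hint
    refine lt_of_lt_of_le ?_ hint
    rw [div_lt_iff₀ hε] at hN
    have : 2 * K / N < ε := by rw [div_lt_iff₀ hN']; linarith
    linarith
  · refine abs_sub_le_iff.2 ⟨?_, ?_⟩
    · have := extremalFn_sub_le hK₁ hx hy
        (D := c * lineAngle x y + |Real.log ‖x‖ - Real.log ‖y‖|) fun n => by
        linarith [(abs_sub_le_iff.1 (hreg n x hx y hy)).1]
      linarith
    · have := extremalFn_sub_le hK₁ hy hx
        (D := c * lineAngle x y + |Real.log ‖x‖ - Real.log ‖y‖|) fun n => by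
        linarith [(abs_sub_le_iff.1 (hreg n x hx y hy)).2]
      linarith

end OneStepLyapunov
end Barabanov

end

/-! ### Conclusion -/

theorem mainTheorem4 (k : ℕ) (hk : 2 ≤ k) (A : Fin k → GL (Fin 2) ℝ)
    (hA : Barabanov.IsDominated (Barabanov.shift k) (Barabanov.oneStep A))
    (M : Set Barabanov.Plane) (hM : Barabanov.IsMulticone M)
    (hinv : Barabanov.IsForwardInvariant A M) :
    ∃ pTop pBot : Barabanov.Plane → ℝ,
      (∀ x ∈ M,
        IsGreatest (Set.range fun i : Fin k => pTop (Barabanov.act (A i) x))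
          (pTop x + Barabanov.lambdaTop A)) ∧
      (∀ x ∈ M,
        IsLeast (Set.range fun i : Fin k => pBot (Barabanov.act (A i) x))
          (pBot x + Barabanov.lambdaBot A)) ∧
      (∀ x ∈ M, ∀ t : ℝ, t ≠ 0 →
        pTop (t • x) = pTop x + Real.log |t| ∧ pBot (t • x) = pBot x + Real.log |t|) ∧
      ∃ c₀ > (0 : ℝ), ∀ x ∈ M, ∀ y ∈ M,
        |pTop x - pTop y| ≤
            c₀ * Barabanov.lineAngle x y + |Real.log ‖x‖ - Real.log ‖y‖| ∧
        |pBot x - pBot y| ≤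
            c₀ * Barabanov.lineAngle x y + |Real.log ‖x‖ - Real.log ‖y‖| := by
  have : NeZero k := ⟨by omega⟩
  obtain ⟨l, p, hle, hlt, hp, hhom, c, hc, hreg⟩ :=
    Barabanov.exists_extremal (σ := 1) hM hinv (by simp)
  -- For `σ = -1` everything is negated: `-q` is the lower function and `-l'` the minimal exponent.
  obtain ⟨l', q, hle', hlt', hq, hhom', c', hc', hreg'⟩ :=
    Barabanov.exists_extremal (σ := -1) hM hinv (by simp)
  have htop : Barabanov.lambdaTop A = l := by
    obtain ⟨μ₀, hμ₀, -⟩ := hlt 1 one_pos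
    refine csSup_eq_of_forall_le_of_forall_lt_exists_gt ⟨_, μ₀, hμ₀, rfl⟩ ?_ fun w hw => ?_
    · rintro _ ⟨μ, hμ, rfl⟩
      linarith [hle μ hμ]
    · obtain ⟨μ, hμ, h⟩ := hlt (l - w) (by linarith)
      exact ⟨_, ⟨μ, hμ, rfl⟩, by linarith⟩
  have hbot : Barabanov.lambdaBot A = -l' := by
    obtain ⟨μ₀, hμ₀, -⟩ := hlt' 1 one_pos
    refine csInf_eq_of_forall_ge_of_forall_gt_exists_lt ⟨_, μ₀, hμ₀, rfl⟩ ?_ fun w hw => ?_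
    · rintro _ ⟨μ, hμ, rfl⟩
      linarith [hle' μ hμ]
    · obtain ⟨μ, hμ, h⟩ := hlt' (w + l') (by linarith)
      exact ⟨_, ⟨μ, hμ, rfl⟩, by linarith⟩
  refine ⟨p, fun x => -q x, fun x hx => htop ▸ hp x hx, fun x hx => ?_, fun x hx t ht => ?_,
    max c c', lt_max_of_lt_left hc, fun x hx y hy => ?_⟩
  · rw [hbot]
    obtain ⟨⟨i, hi⟩, hub⟩ := hq x hx
    refine ⟨⟨i, ?_⟩, ?_⟩
    · simp only at hi ⊢
      linarith
    · rintro _ ⟨j, rfl⟩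
      have := hub ⟨j, rfl⟩
      simp only at this ⊢
      linarith
  · refine ⟨by simpa using hhom x hx t ht, ?_⟩
    simp only [hhom' x hx t ht]
    ring
  · have hang : 0 ≤ Barabanov.lineAngle x y :=
      le_min (InnerProductGeometry.angle_nonneg x y)
        (sub_nonneg.2 (InnerProductGeometry.angle_le_pi x y))
    have h1 := mul_le_mul_of_nonneg_right (le_max_left c c') hang
    have h2 := mul_le_mul_of_nonneg_right (le_max_right c c') hang
    refine ⟨(hreg x hx y hy).trans (by linarith), ?_⟩
    rw [show |-q x - -q y| = |q x - q y| by rw [neg_sub_neg, abs_sub_comm]]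
    exact (hreg' x hx y hy).trans (by linarith)
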